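/- Let $X$ and $Y$ be real Banach spaces. Write $X\hat\otimes_\pi Y$ for their projective tensor product, that is, the completion of the algebraic tensor product $X\otimes Y$ with respect to the norm $\|z\|=\sup\{|\tilde S(z)| : S \text{ a continuous bilinear functional on } X\times Y,\ \|S\|\le 1\}$, where $\tilde S$ is the linear functional on $X\otimes Y$ induced by $S$. A Banach space $Z$ has the Dunford–Pettis property if $z_n^*(z_n)\to 0$ whenever $(z_n)_{n\in\mathbb N}$ is a weakly null sequence in $Z$ and $(z_n^*)_{n\in\mathbb N}$ is a weakly null sequence in $Z^*$. A subset of a Banach space is weakly precompact if every sequence in it admits a weakly Cauchy subsequence. By a subspace we mean a norm closed linear subspace. Assume that one of the following conditions holds: (i) either $X$ or $Y$ has the Dunford–Pettis property; (ii) every continuous linear operator from $X$ to $Y^*$ is compact. Then: (a) If $(x_n)_{n\in\mathbb N}$ and $(y_n)_{n\in\mathbb N}$ are weakly Cauchy sequences in $X$ and $Y$, respectively, then $(x_n\otimes y_n)_{n\in\mathbb N}$ is weakly Cauchy in $X\hat\otimes_\pi Y$. (b) If $W_1\subseteq X$ and $W_2\subseteq Y$ are weakly precompact sets, then $W_1\otimes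 W_2=\{x\otimes y : x\in W_1,\ y\in W_2\}$ is weakly precompact in $X\hat\otimes_\pi Y$. (c) If $X$ and $Y$ contain no subspace isomorphic to $\ell_1$, then $X\hat\otimes_\pi Y$ contains no subspace isomorphic to $\ell_1$. -/

import Mathlib

set_option maxSynthPendingDepth 3

open scoped TensorProduct

/-- A sequence in a normed space is weakly Cauchy if every continuous linear functional maps it to
a Cauchy (equivalently, convergent) sequence of scalars. -/
def WeaklyCauchySeq {X : Type*} [NormedAddCommGroup X] [NormedSpace ℝ X] (x : ℕ → X) : Prop :=
  ∀ f : StrongDual ℝ X, CauchySeq fun n => f (x n)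

/-- A sequence in a normed space is weakly null if it converges weakly to zero. -/
def WeaklyNullSeq {X : Type*} [NormedAddCommGroup X] [NormedSpace ℝ X] (x : ℕ → X) : Prop :=
  ∀ f : StrongDual ℝ X, Filter.Tendsto (fun n => f (x n)) Filter.atTop (nhds 0)

/-- A set is weakly precompact if every sequence in it admits a weakly Cauchy subsequence. -/
def WeaklyPrecompact {X : Type*} [NormedAddCommGroup X] [NormedSpace ℝ X] (W : Set X) : Prop :=
  ∀ x : ℕ → X, (∀ n, x n ∈ W) → ∃ φ : ℕ → ℕ, StrictMono φ ∧ WeaklyCauchySeq (x ∘ φ)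

/-- The Dunford-Pettis property: `x*ₙ(xₙ) → 0` whenever `(xₙ)` is weakly null in `X` and `(x*ₙ)`
is weakly null in the Banach space `X*` (for its own weak topology, given by the bidual). -/
def DunfordPettisProperty (X : Type*) [NormedAddCommGroup X] [NormedSpace ℝ X] : Prop :=
  ∀ (x : ℕ → X) (f : ℕ → StrongDual ℝ X), WeaklyNullSeq x → WeaklyNullSeq f →
    Filter.Tendsto (fun n => f n (x n)) Filter.atTop (nhds 0)

/-- `X` contains a (closed linear) subspace isomorphic to `ℓ₁`. -/
def ContainsEllOne (X : Type*) [NormedAddCommGroup X] [NormedSpace ℝ X] : Prop :=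
  ∃ Z : Submodule ℝ X, IsClosed (Z : Set X) ∧
    Nonempty (lp (fun _ : ℕ => ℝ) 1 ≃L[ℝ] Z)

/-- The algebraic tensor product `X ⊗ Y`. It is a type of its own, so that the projective norm
below does not clash with other norms on tensor products. -/
def AlgTensor (X Y : Type*) [NormedAddCommGroup X] [NormedSpace ℝ X]
    [NormedAddCommGroup Y] [NormedSpace ℝ Y] : Type _ :=
  X ⊗[ℝ] Y

namespace AlgTensor

section Construction

variable (X Y : Type*) [NormedAddCommGroup X] [NormedSpace ℝ X]
  [NormedAddCommGroup Y] [NormedSpace ℝ Y]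

noncomputable instance instAddCommGroup : AddCommGroup (AlgTensor X Y) :=
  inferInstanceAs (AddCommGroup (X ⊗[ℝ] Y))

noncomputable instance instModule : Module ℝ (AlgTensor X Y) :=
  inferInstanceAs (Module ℝ (X ⊗[ℝ] Y))

variable {X Y}

/-- The elementary tensor `x ⊗ y` in the algebraic tensor product. -/
noncomputable def tmul (x : X) (y : Y) : AlgTensor X Y :=
  x ⊗ₜ[ℝ] y

/-- The linear functional on `X ⊗ Y` induced by a continuous bilinear functional `S` on `X × Y`. -/
noncomputable def extend (S : X →L[ℝ] Y →L[ℝ] ℝ) : AlgTensor X Y →ₗ[ℝ] ℝ :=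
  TensorProduct.lift (S.toLinearMap₁₂ : X →ₗ[ℝ] Y →ₗ[ℝ] ℝ)

theorem extend_tmul (S : X →L[ℝ] Y →L[ℝ] ℝ) (x : X) (y : Y) :
    extend S (tmul x y) = S x y :=
  rfl

/-- The projective norm: the supremum of `|S̃(z)|` over all continuous bilinear functionals `S` on
`X × Y` with `‖S‖ ≤ 1`. -/
noncomputable def projNorm (z : AlgTensor X Y) : ℝ :=
  ⨆ S : {S : X →L[ℝ] Y →L[ℝ] ℝ // ‖S‖ ≤ 1}, |extend S.1 z|

theorem bddAbove_projNorm (z : AlgTensor X Y) :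
    BddAbove (Set.range fun S : {S : X →L[ℝ] Y →L[ℝ] ℝ // ‖S‖ ≤ 1} => |extend S.1 z|) := by
  refine TensorProduct.induction_on (motive := fun z : X ⊗[ℝ] Y =>
    BddAbove (Set.range fun S : {S : X →L[ℝ] Y →L[ℝ] ℝ // ‖S‖ ≤ 1} =>
      |extend S.1 (z : AlgTensor X Y)|)) z ?_ ?_ ?_
  · refine ⟨0, ?_⟩
    rintro _ ⟨S, rfl⟩
    exact (abs_eq_zero.2 (map_zero (extend S.1))).le
  · intro x y
    refine ⟨1 * ‖x‖ * ‖y‖, ?_⟩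
    rintro _ ⟨S, rfl⟩
    refine (S.1.le_opNorm₂ x y).trans ?_
    have := S.2
    gcongr
  · rintro a b ⟨A, hA⟩ ⟨B, hB⟩
    refine ⟨A + B, ?_⟩
    rintro _ ⟨S, rfl⟩
    refine (congrArg abs (map_add (extend S.1) a b)).le.trans ((abs_add_le _ _).trans ?_)
    exact add_le_add (hA ⟨S, rfl⟩) (hB ⟨S, rfl⟩)

theorem abs_extend_le_projNorm (S : X →L[ℝ] Y →L[ℝ] ℝ) (hS : ‖S‖ ≤ 1) (z : AlgTensor X Y) :
    |extend S z| ≤ projNorm z :=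
  le_ciSup (bddAbove_projNorm z) ⟨S, hS⟩

theorem projNorm_le {z : AlgTensor X Y} {c : ℝ}
    (h : ∀ S : X →L[ℝ] Y →L[ℝ] ℝ, ‖S‖ ≤ 1 → |extend S z| ≤ c) : projNorm z ≤ c :=
  haveI : Nonempty {S : X →L[ℝ] Y →L[ℝ] ℝ // ‖S‖ ≤ 1} := ⟨⟨0, norm_zero.trans_le zero_le_one⟩⟩
  ciSup_le fun S => h S.1 S.2

/-- The projective norm as a seminorm. -/
noncomputable def projSeminorm : Seminorm ℝ (AlgTensor X Y) :=
  Seminorm.ofSMulLE projNorm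
    (le_antisymm (projNorm_le fun S _ => by simp)
      ((abs_nonneg _).trans (abs_extend_le_projNorm 0 (norm_zero.trans_le zero_le_one) 0)))
    (fun a b => projNorm_le fun S hS => by
      rw [map_add]
      exact (abs_add_le _ _).trans
        (add_le_add (abs_extend_le_projNorm S hS a) (abs_extend_le_projNorm S hS b)))
    (fun r a => projNorm_le fun S hS => by
      rw [map_smul, smul_eq_mul, abs_mul, Real.norm_eq_abs]
      exact mul_le_mul_of_nonneg_left (abs_extend_le_projNorm S hS a) (abs_nonneg r))

noncomputable instance instSeminormedAddCommGroup : SeminormedAddCommGroup (AlgTensor X Y) :=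
  AddGroupSeminorm.toSeminormedAddCommGroup (projSeminorm (X := X) (Y := Y)).toAddGroupSeminorm

theorem norm_def (z : AlgTensor X Y) : ‖z‖ = projNorm z :=
  rfl

noncomputable instance instNormedSpace : NormedSpace ℝ (AlgTensor X Y) :=
  ⟨fun r z => (map_smul_eq_mul (projSeminorm (X := X) (Y := Y)) r z).le⟩

end Construction

end AlgTensor

/-- The projective tensor product of `X` and `Y`: the completion of `X ⊗ Y` with respect to the
projective norm. -/
abbrev ProjTensor (X Y : Type*) [NormedAddCommGroup X] [NormedSpace ℝ X]
    [NormedAddCommGroup Y] [NormedSpace ℝ Y] : Type _ :=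
  UniformSpace.Completion (AlgTensor X Y)

/-- The elementary tensor `x ⊗ y` in the projective tensor product. -/
noncomputable def ProjTensor.tmul {X Y : Type*} [NormedAddCommGroup X] [NormedSpace ℝ X]
    [NormedAddCommGroup Y] [NormedSpace ℝ Y] (x : X) (y : Y) : ProjTensor X Y :=
  ((AlgTensor.tmul x y : AlgTensor X Y) : UniformSpace.Completion (AlgTensor X Y))

/-!
Under either hypothesis a continuous bilinear functional `S` sends pairs of weakly null sequences to
null sequences: with the Dunford-Pettis property this is the definition, applied to the weakly null
sequence `S (·, yₙ)` or `S (xₙ, ·)` in the dual, and otherwise the compact operator `S : X → Y*` is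
completely continuous. A subsequence argument extends this to weakly Cauchy sequences
(`cauchySeq_of_weaklyCauchySeq`). As functionals on the projective tensor product are bilinear
functionals, elementary tensors of weakly Cauchy sequences are weakly Cauchy, and elementary tensors
of weakly precompact sets form a weakly precompact set.

If `X` and `Y` contain no copy of `ℓ₁`, then by Rosenthal's theorem (`weaklyPrecompact_closedBall`)
their unit balls are weakly precompact, and so is the set `W` of elementary tensors of their
elements. By Hahn-Banach, the closed convex hull of `W` contains the unit ball of the tensor product
(`ProjTensor.closedBall_subset_closure_convexHull`). It remains to see that such a space `Z` contains
no copy of `ℓ₁` (`WeaklyPrecompact.not_containsEllOne`). If it did, functionals on `Z` could take any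
pattern of signs on the basis `(uₖ)`; averaging over the patterns gives a probability measure `μ` on
a weak* compact ball of `Z*` on which the `uₖ` behave like Rademacher functions. The evaluation
operator `Z → L¹(μ)` maps weakly Cauchy sequences to norm convergent ones, by dominated convergence,
so it maps `W` and then the unit ball to a totally bounded set; but the images of the `uₖ` are
uniformly separated.

Rosenthal's theorem rests on a combinatorial dichotomy (`exists_independent_subseq`): a sequence of
pairs of sets without a convergent subsequence has an independent subsequence, which is selected term
by term so that the remaining pairs keep oscillating on all intersections formed so far.
-/

open Filter Topology MeasureTheory

/-! ### Independent sequences of pairs of sets -/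

/-- Given a sequence of pairs `(C false n, C true n)` of subsets of `S`, the pairs with index in `N`
converge on `E` if each point of `E` lies in only finitely many of the `C false n`, or in only
finitely many of the `C true n`, with `n ∈ N`. -/
def PairsConvergeOn {S : Type*} (C : Bool → ℕ → Set S) (N : Set ℕ) (E : Set S) : Prop :=
  ∀ x ∈ E, ∃ b, {n ∈ N | x ∈ C b n}.Finite

/-- The pairs with index in `M` oscillate on `E` if no infinite subfamily converges on `E`. -/
def PairsOscillateOn {S : Type*} (C : Bool → ℕ → Set S) (M : Set ℕ) (E : Set S) : Prop :=
  ∀ N ⊆ M, N.Infinite → ¬ PairsConvergeOn C N E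

theorem PairsOscillateOn.nonempty {S : Type*} {C : Bool → ℕ → Set S} {M : Set ℕ} {E : Set S}
    (h : PairsOscillateOn C M E) (hM : M.Infinite) : E.Nonempty := by
  rw [Set.nonempty_iff_ne_empty]
  rintro rfl
  exact h M subset_rfl hM fun x hx => hx.elim

/-- Diagonal argument: if each `P k` can be achieved on an infinite subset of any given infinite
subset of `M`, then one sequence in `M` is eventually in sets having `P k`, for all `k`. -/
theorem exists_strictMono_diagonal {M : Set ℕ} (hM : M.Infinite) (P : ℕ → Set ℕ → Prop)
    (h : ∀ k, ∀ N ⊆ M, N.Infinite → ∃ L ⊆ N, L.Infinite ∧ P k L) :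
    ∃ φ : ℕ → ℕ, StrictMono φ ∧ (∀ j, φ j ∈ M) ∧ ∃ N : ℕ → Set ℕ, (∀ k, P k (N k)) ∧
      ∀ k j, k ≤ j → φ j ∈ N k := by
  choose! g hgN hgi hgP using h
  let N : ℕ → Set ℕ := fun k => Nat.rec (g 0 M) (fun k L => g (k + 1) L) k
  have hN : ∀ k, N k ⊆ M ∧ (N k).Infinite := by
    intro k
    induction k with
    | zero => exact ⟨hgN 0 M subset_rfl hM, hgi 0 M subset_rfl hM⟩
    | succ k ih => exact ⟨(hgN _ _ ih.1 ih.2).trans ih.1, hgi _ _ ih.1 ih.2⟩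
  have hanti : Antitone N := antitone_nat_of_succ_le fun k => hgN (k + 1) _ (hN k).1 (hN k).2
  obtain ⟨φ, hφ, hφN⟩ := extraction_forall_of_frequently (P := fun k n => n ∈ N k)
    fun k => Nat.frequently_atTop_iff_infinite.2 (hN k).2
  refine ⟨φ, hφ, fun j => (hN j).1 (hφN j), N, fun k => ?_, fun k j hkj => hanti hkj (hφN j)⟩
  cases k with
  | zero => exact hgP 0 M subset_rfl hM
  | succ k => exact hgP _ _ (hN k).1 (hN k).2

/-- If the pairs with index in `M` oscillate on finitely many sets, then there is an index `n` such
that the pairs still oscillate, after shrinking `M`, on the traces of these sets on both halves of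
the `n`-th pair. Otherwise a diagonal sequence of indices `n` could be found whose pairs converge on
the trace of a fixed `E i` on a fixed half of each of them, hence converge on all of `E i`: a point
of `E i` outside all these halves is no obstacle. -/
theorem exists_pairsOscillateOn_inter {S : Type*} {C : Bool → ℕ → Set S} {M : Set ℕ}
    (hM : M.Infinite) {𝓔 : Set (Set S)} (h𝓔 : 𝓔.Finite)
    (h : ∀ E ∈ 𝓔, PairsOscillateOn C M E) :
    ∃ n ∈ M, ∃ N ⊆ M, N.Infinite ∧ (∀ m ∈ N, n < m) ∧
      ∀ E ∈ 𝓔, ∀ b, PairsOscillateOn C N (E ∩ C b n) := by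
  by_contra! hcon
  have key : ∀ n, ∀ N ⊆ M, N.Infinite → ∃ L ⊆ N, L.Infinite ∧
      (n ∈ M → ∃ p : 𝓔 × Bool, PairsConvergeOn C L (p.1 ∩ C p.2 n)) := by
    intro n N hNM hN
    by_cases hn : n ∈ M
    · obtain ⟨E, hE, b, hb⟩ := hcon n hn (N \ Set.Iic n) (Set.sdiff_subset.trans hNM)
        (hN.sdiff (Set.finite_Iic n)) (fun m hm => not_le.1 hm.2)
      simp only [PairsOscillateOn, not_forall, not_not] at hb
      obtain ⟨L, hL, hLi, hconv⟩ := hb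
      exact ⟨L, hL.trans Set.sdiff_subset, hLi, fun _ => ⟨⟨⟨E, hE⟩, b⟩, hconv⟩⟩
    · exact ⟨N, subset_rfl, hN, fun h => absurd h hn⟩
  obtain ⟨φ, hφ, hφM, N, hN, hφN⟩ := exists_strictMono_diagonal hM _ key
  choose p hp using fun j => hN (φ j) (hφM j)
  have : Finite 𝓔 := h𝓔
  obtain ⟨⟨E, b⟩, hJ⟩ := Finite.exists_infinite_fiber p
  have hJ := Set.infinite_coe_iff.1 hJ
  refine h E E.2 (φ '' (p ⁻¹' {(E, b)})) ?_ (hJ.image hφ.injective.injOn) ?_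
  · rintro _ ⟨j, -, rfl⟩
    exact hφM j
  intro x hx
  by_cases hxb : ∃ j, p j = (E, b) ∧ x ∈ C b (φ j)
  · obtain ⟨j, hj, hxj⟩ := hxb
    have hc := hp j
    rw [hj] at hc
    obtain ⟨b', hb'⟩ := hc x ⟨hx, hxj⟩
    refine ⟨b', (hb'.union ((Set.finite_lt_nat (φ j)).image φ)).subset ?_⟩
    rintro _ ⟨⟨i, -, rfl⟩, hxi⟩
    rcases lt_or_ge i (φ j) with hi | hi
    · exact Or.inr ⟨i, hi, rfl⟩
    · exact Or.inl ⟨hφN _ _ hi, hxi⟩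
  · push Not at hxb
    refine ⟨b, Set.finite_empty.subset ?_⟩
    rintro _ ⟨⟨i, hi, rfl⟩, hxi⟩
    exact hxb i hi hxi

/-- Rosenthal's dichotomy for sets: a sequence of pairs without a convergent subsequence has an
independent subsequence. -/
theorem exists_independent_subseq {S : Type*} {C : Bool → ℕ → Set S}
    (h : PairsOscillateOn C Set.univ Set.univ) :
    ∃ φ : ℕ → ℕ, StrictMono φ ∧ ∀ (k : ℕ) (ε : ℕ → Bool), ∃ x, ∀ j < k, x ∈ C (ε j) (φ j) := by
  -- A state is a finite family of sets, with an infinite set of indices oscillating on all of them.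
  let State := {p : Set (Set S) × Set ℕ //
    p.1.Finite ∧ p.2.Infinite ∧ ∀ E ∈ p.1, PairsOscillateOn C p.2 E}
  have step : ∀ p : State, ∃ (n : ℕ) (q : State), n ∈ p.1.2 ∧ q.1.2 ⊆ p.1.2 ∧
      (∀ m ∈ q.1.2, n < m) ∧ ∀ E ∈ p.1.1, ∀ b, E ∩ C b n ∈ q.1.1 := by
    rintro ⟨⟨𝓔, M⟩, h𝓔, hM, hosc⟩
    obtain ⟨n, hn, N, hNM, hN, hlt, hE⟩ := exists_pairsOscillateOn_inter hM h𝓔 hosc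
    refine ⟨n, ⟨⟨Set.image2 (fun E b => E ∩ C b n) 𝓔 Set.univ, N⟩,
      h𝓔.image2 _ Set.finite_univ, hN, ?_⟩, hn, hNM, hlt, fun E hE b => ⟨E, hE, b, trivial, rfl⟩⟩
    rintro _ ⟨E, hE', b, -, rfl⟩
    exact hE E hE' b
  choose n next hn hsub hlt hmem using step
  let st : ℕ → State := fun k => Nat.rec
    ⟨⟨{Set.univ}, Set.univ⟩, Set.finite_singleton _, Set.infinite_univ, by simpa using h⟩
    (fun _ p => next p) k
  refine ⟨fun k => n (st k), strictMono_nat_of_lt_succ fun k => hlt _ _ (hn (st (k + 1))), ?_⟩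
  intro k ε
  have key : ∀ k, ∃ E ∈ (st k).1.1, ∀ x ∈ E, ∀ j < k, x ∈ C (ε j) (n (st j)) := by
    intro k
    induction k with
    | zero => exact ⟨Set.univ, rfl, by simp⟩
    | succ k ih =>
      obtain ⟨E, hE, hx⟩ := ih
      refine ⟨E ∩ C (ε k) (n (st k)), hmem (st k) E hE (ε k), fun x hx' j hj => ?_⟩
      rcases Nat.lt_succ_iff_lt_or_eq.1 hj with hj | rfl
      · exact hx x hx'.1 j hj
      · exact hx'.2
  obtain ⟨E, hE, hx⟩ := key k
  obtain ⟨x, hxE⟩ := ((st k).2.2.2 E hE).nonempty (st k).2.2.1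
  exact ⟨x, hx x hxE⟩

/-- Rosenthal's dichotomy for functions: a uniformly bounded sequence has a pointwise convergent
subsequence, or a subsequence for which the sets `{f < r}` and `{s < f}` are independent, for some
`r < s`. The sets for rational `r < s` control the lower and the upper limits, so if no such
subsequence exists, the dichotomy for sets and a diagonal argument over these countably many pairs
give convergence. -/
theorem exists_pointwise_convergent_or_independent {S : Type*} (f : ℕ → S → ℝ) {c : ℝ}
    (hf : ∀ n x, |f n x| ≤ c) :
    (∃ φ : ℕ → ℕ, StrictMono φ ∧ ∀ x, ∃ l, Tendsto (fun n => f (φ n) x) atTop (𝓝 l)) ∨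
    ∃ r s : ℝ, r < s ∧ ∃ φ : ℕ → ℕ, StrictMono φ ∧
      ∀ (k : ℕ) (ε : ℕ → Bool), ∃ x, ∀ j < k,
        (ε j = false → f (φ j) x < r) ∧ (ε j = true → s < f (φ j) x) := by
  rw [or_iff_not_imp_right]
  intro hind
  obtain ⟨q, hq⟩ := exists_surjective_nat (ℚ × ℚ)
  let C : ℚ × ℚ → Bool → ℕ → Set S := fun p b n =>
    cond b {x | (p.2 : ℝ) < f n x} {x | f n x < (p.1 : ℝ)}
  have key : ∀ k, ∀ N ⊆ (Set.univ : Set ℕ), N.Infinite → ∃ L ⊆ N, L.Infinite ∧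
      ((q k).1 < (q k).2 → PairsConvergeOn (C (q k)) L Set.univ) := by
    intro k N _ hN
    by_cases hk : (q k).1 < (q k).2
    swap
    · exact ⟨N, subset_rfl, hN, fun h => absurd h hk⟩
    by_contra! hcon
    have hosc : PairsOscillateOn (fun b n => C (q k) b (Nat.nth (· ∈ N) n)) Set.univ Set.univ := by
      intro L _ hL hconv
      have hinj := (Nat.nth_strictMono hN).injective
      refine (hcon (Nat.nth (· ∈ N) '' L) ?_ (hL.image hinj.injOn)).2 fun x hx => ?_
      · rintro _ ⟨j, -, rfl⟩
        exact Nat.nth_mem_of_infinite hN j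
      · obtain ⟨b, hb⟩ := hconv x hx
        refine ⟨b, (hb.image (Nat.nth (· ∈ N))).subset ?_⟩
        rintro _ ⟨⟨j, hj, rfl⟩, hxj⟩
        exact ⟨j, ⟨hj, hxj⟩, rfl⟩
    obtain ⟨φ, hφ, hind'⟩ := exists_independent_subseq hosc
    refine hind ⟨(q k).1, (q k).2, by exact_mod_cast hk, fun j => Nat.nth (· ∈ N) (φ j),
      (Nat.nth_strictMono hN).comp hφ, fun m ε => ?_⟩
    obtain ⟨x, hx⟩ := hind' m ε
    refine ⟨x, fun j hj => ⟨fun h => ?_, fun h => ?_⟩⟩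
    · simpa [C, h] using hx j hj
    · simpa [C, h] using hx j hj
  obtain ⟨φ, hφ, -, N, hN, hφN⟩ := exists_strictMono_diagonal Set.infinite_univ _ key
  refine ⟨φ, hφ, fun x => ?_⟩
  refine tendsto_of_no_upcrossings (s := Set.range ((↑) : ℚ → ℝ)) Rat.denseRange_cast ?_
    (isBoundedUnder_of ⟨c, fun n => (abs_le.1 (hf _ x)).2⟩)
    (isBoundedUnder_of ⟨-c, fun n => (abs_le.1 (hf _ x)).1⟩)
  rintro _ ⟨a, rfl⟩ _ ⟨b, rfl⟩ hab ⟨ha, hb⟩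
  obtain ⟨k, hk⟩ := hq (a, b)
  obtain ⟨d, hd⟩ := hN k (by rw [hk]; exact_mod_cast hab) x trivial
  rw [hk] at hd
  have hd' : {j | k ≤ j ∧ x ∈ C (a, b) d (φ j)}.Finite :=
    (hd.preimage hφ.injective.injOn).subset fun j hj => ⟨hφN _ _ hj.1, hj.2⟩
  cases d with
  | false =>
    exact Nat.frequently_atTop_iff_infinite.1 (ha.and_eventually (eventually_ge_atTop k))
      (hd'.subset fun j hj => ⟨hj.2, hj.1⟩)
  | true =>
    exact Nat.frequently_atTop_iff_infinite.1 (hb.and_eventually (eventually_ge_atTop k))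
      (hd'.subset fun j hj => ⟨hj.2, hj.1⟩)

/-! ### Operators on `ℓ₁` and Rosenthal's theorem -/

theorem lp_one_hasSum_norm (a : lp (fun _ : ℕ => ℝ) 1) : HasSum (fun k => ‖a k‖) ‖a‖ := by
  simpa using lp.hasSum_norm (p := 1) (by simp) a

/-- The operator `ℓ₁ → X` that maps the unit vector basis to a given sequence in the unit ball. -/
noncomputable def ellOneLift {X : Type*} [NormedAddCommGroup X] [NormedSpace ℝ X] [CompleteSpace X]
    (x : ℕ → X) (hx : ∀ k, ‖x k‖ ≤ 1) : lp (fun _ : ℕ => ℝ) 1 →L[ℝ] X :=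
  have hle : ∀ (a : lp (fun _ : ℕ => ℝ) 1) k, ‖a k • x k‖ ≤ ‖a k‖ := fun a k => by
    rw [norm_smul]
    exact mul_le_of_le_one_right (norm_nonneg _) (hx k)
  have hs : ∀ a : lp (fun _ : ℕ => ℝ) 1, Summable fun k => a k • x k := fun a =>
    .of_norm_bounded (lp_one_hasSum_norm a).summable (hle a)
  LinearMap.mkContinuous
    { toFun := fun a => ∑' k, a k • x k
      map_add' := fun a b => by
        rw [← (hs a).tsum_add (hs b)]
        simp [add_smul]
      map_smul' := fun r a => by
        rw [RingHom.id_apply, ← (hs a).tsum_const_smul]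
        simp [mul_smul] } 1
    fun a => by
      rw [one_mul]
      exact tsum_of_norm_bounded (lp_one_hasSum_norm a) (hle a)

section EllOneLift

variable {X : Type*} [NormedAddCommGroup X] [NormedSpace ℝ X] [CompleteSpace X]
  {x : ℕ → X} (hx : ∀ k, ‖x k‖ ≤ 1)

theorem hasSum_ellOneLift (a : lp (fun _ : ℕ => ℝ) 1) :
    HasSum (fun k => a k • x k) (ellOneLift x hx a) := by
  refine Summable.hasSum (.of_norm_bounded (lp_one_hasSum_norm a).summable fun k => ?_)
  rw [norm_smul]
  exact mul_le_of_le_one_right (norm_nonneg _) (hx k)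

theorem norm_ellOneLift_le : ‖ellOneLift x hx‖ ≤ 1 := by
  refine ContinuousLinearMap.opNorm_le_bound _ zero_le_one fun a => ?_
  rw [one_mul, ← (hasSum_ellOneLift hx a).tsum_eq]
  refine tsum_of_norm_bounded (lp_one_hasSum_norm a) fun k => ?_
  rw [norm_smul]
  exact mul_le_of_le_one_right (norm_nonneg _) (hx k)

theorem ellOneLift_single (k : ℕ) : ellOneLift x hx (lp.single 1 k 1) = x k := by
  refine (hasSum_ellOneLift hx _).unique ?_
  convert hasSum_ite_eq k (x k) using 2 with j
  by_cases h : j = k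
  · subst h; simp
  · simp [h]

end EllOneLift

section Rosenthal

variable {X : Type*} [NormedAddCommGroup X] [NormedSpace ℝ X]

/-- If functionals in the dual unit ball can separate the terms of `x` according to any pattern,
with a gap from `r` to `s`, then `x` satisfies a lower `ℓ₁` estimate. -/
theorem ellOne_lower_bound {x : ℕ → X} {r s : ℝ} {n : ℕ}
    (hind : ∀ ε : ℕ → Bool, ∃ f : StrongDual ℝ X, ‖f‖ ≤ 1 ∧ ∀ j < n,
      (ε j = false → f (x j) < r) ∧ (ε j = true → s < f (x j))) (a : ℕ → ℝ) :
    (s - r) / 2 * ∑ k ∈ Finset.range n, |a k| ≤ ‖∑ k ∈ Finset.range n, a k • x k‖ := by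
  obtain ⟨f, hf, hfx⟩ := hind fun k => decide (0 < a k)
  obtain ⟨g, hg, hgx⟩ := hind fun k => !decide (0 < a k)
  have hle : (s - r) * ∑ k ∈ Finset.range n, |a k| ≤ (f - g) (∑ k ∈ Finset.range n, a k • x k) := by
    rw [map_sum, Finset.mul_sum]
    refine Finset.sum_le_sum fun k hk => ?_
    have hk := Finset.mem_range.1 hk
    rw [map_smul, _root_.sub_apply, smul_eq_mul]
    rcases lt_or_ge 0 (a k) with h | h
    · have h1 := (hfx k hk).2 (by simpa using h)
      have h2 := (hgx k hk).1 (by simpa using h)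
      rw [abs_of_pos h, mul_comm]
      gcongr
    · have h1 := (hfx k hk).1 (by simpa using h)
      have h2 := (hgx k hk).2 (by simpa using h)
      rw [abs_of_nonpos h]
      nlinarith
  have hn : ‖f - g‖ ≤ 2 := (norm_sub_le _ _).trans (by linarith)
  have := (f - g).le_of_opNorm_le hn (∑ k ∈ Finset.range n, a k • x k)
  have := (le_abs_self _).trans this
  linarith

/-- With a lower `ℓ₁` estimate, the operator `ellOneLift` is an isomorphism onto its range. -/
theorem containsEllOne_of_lower_bound [CompleteSpace X] {x : ℕ → X} (hx : ∀ k, ‖x k‖ ≤ 1) {δ : ℝ}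
    (hδ : 0 < δ) (h : ∀ (n : ℕ) (a : ℕ → ℝ),
      δ * ∑ k ∈ Finset.range n, |a k| ≤ ‖∑ k ∈ Finset.range n, a k • x k‖) :
    ContainsEllOne X := by
  have hb : ∀ a, δ * ‖a‖ ≤ ‖ellOneLift x hx a‖ := fun a =>
    le_of_tendsto_of_tendsto'
      ((lp_one_hasSum_norm a).tendsto_sum_nat.const_mul δ)
      (hasSum_ellOneLift hx a).tendsto_sum_nat.norm fun n => h n a
  have hanti : AntilipschitzWith (Real.toNNReal δ⁻¹) (ellOneLift x hx) := by
    refine (ellOneLift x hx).antilipschitz_of_bound fun a => ?_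
    rw [Real.coe_toNNReal _ (inv_nonneg.2 hδ.le), inv_mul_eq_div, le_div_iff₀ hδ, mul_comm]
    exact hb a
  have hclosed := hanti.isClosed_range (ellOneLift x hx).uniformContinuous
  exact ⟨(ellOneLift x hx).range, hclosed,
    ⟨(ellOneLift x hx).equivRange hanti.injective hclosed⟩⟩

/-- **Rosenthal's `ℓ₁` theorem**: in a Banach space without a copy of `ℓ₁`, every sequence in the
unit ball has a weakly Cauchy subsequence. The dichotomy is applied to the sequence as functions on
the dual unit ball. -/
theorem weaklyPrecompact_closedBall [CompleteSpace X] (hX : ¬ ContainsEllOne X) :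
    WeaklyPrecompact (Metric.closedBall (0 : X) 1) := by
  intro x hx
  have hx : ∀ n, ‖x n‖ ≤ 1 := fun n => by simpa using hx n
  rcases exists_pointwise_convergent_or_independent
    (fun n (f : {f : StrongDual ℝ X // ‖f‖ ≤ 1}) => f.1 (x n)) (c := 1)
    (fun n f => (f.1.le_opNorm _).trans (mul_le_one₀ f.2 (norm_nonneg _) (hx n))) with
    ⟨φ, hφ, h⟩ | ⟨r, s, hrs, φ, -, hind⟩
  · refine ⟨φ, hφ, fun f => ?_⟩
    have hf : 0 < ‖f‖ + 1 := by positivity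
    obtain ⟨l, hl⟩ := h ⟨(‖f‖ + 1)⁻¹ • f, by
      rw [norm_smul, Real.norm_of_nonneg (inv_nonneg.2 hf.le), inv_mul_le_one₀ hf]
      linarith⟩
    refine ((hl.const_mul (‖f‖ + 1)).congr fun n => ?_).cauchySeq
    simp [hf.ne']
  · refine absurd (containsEllOne_of_lower_bound (x := x ∘ φ) (fun k => hx _)
      (half_pos (sub_pos.2 hrs)) fun n a => ellOne_lower_bound (fun ε => ?_) a) hX
    obtain ⟨f, hf⟩ := hind n ε
    exact ⟨f.1, f.2, hf⟩

end Rosenthal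

/-! ### Convex hulls of weakly precompact sets -/

theorem WeaklyCauchySeq.exists_norm_le {X : Type*} [NormedAddCommGroup X] [NormedSpace ℝ X]
    {x : ℕ → X} (hx : WeaklyCauchySeq x) : ∃ c, ∀ n, ‖x n‖ ≤ c := by
  obtain ⟨c, hc⟩ := banach_steinhaus (g := fun n => NormedSpace.inclusionInDoubleDual ℝ X (x n))
    fun f => by
      obtain ⟨c, hc⟩ := (hx f).isBounded_range.exists_norm_le
      exact ⟨c, fun n => hc _ ⟨n, rfl⟩⟩
  exact ⟨c, fun n => ((NormedSpace.inclusionInDoubleDualLi ℝ).norm_map (x n)).symm.trans_le (hc n)⟩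

theorem totallyBounded_of_cauchySeq_subseq {α : Type*} [PseudoMetricSpace α] {s : Set α}
    (h : ∀ u : ℕ → α, (∀ n, u n ∈ s) → ∃ φ : ℕ → ℕ, StrictMono φ ∧ CauchySeq (u ∘ φ)) :
    TotallyBounded s := by
  rw [Metric.totallyBounded_iff]
  by_contra! hcon
  obtain ⟨ε, hε, hcon⟩ := hcon
  obtain ⟨u, hus, hu⟩ := exists_seq_of_forall_finset_exists (· ∈ s) (fun a b => ε ≤ dist b a)
    fun t _ => by
      obtain ⟨y, hy, hyt⟩ := Set.not_subset.1 (hcon t t.finite_toSet)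
      refine ⟨y, hy, fun a ha => ?_⟩
      simp only [Set.mem_iUnion, not_exists] at hyt
      simpa using hyt a ha
  obtain ⟨φ, hφ, hc⟩ := h u hus
  obtain ⟨N, hN⟩ := Metric.cauchySeq_iff'.1 hc ε hε
  exact (hN (N + 1) (Nat.le_succ N)).not_ge (hu _ _ (hφ N.lt_succ_self))

section Measures

variable {K : Type*} [TopologicalSpace K] [CompactSpace K] [MeasurableSpace K] [BorelSpace K]

theorem dist_toLp_one (μ : Measure K) [IsFiniteMeasure μ] (f g : C(K, ℝ)) :
    dist (ContinuousMap.toLp (E := ℝ) 1 μ ℝ f) (ContinuousMap.toLp (E := ℝ) 1 μ ℝ g) =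
      ∫ x, |f x - g x| ∂μ := by
  rw [dist_eq_norm, ← map_sub, L1.norm_eq_integral_norm]
  refine integral_congr_ae ?_
  filter_upwards [ContinuousMap.coeFn_toLp (p := 1) (𝕜 := ℝ) μ (f - g)] with x hx
  rw [hx]
  rfl

/-- On a finite measure space, a bounded pointwise Cauchy sequence is Cauchy in `L¹`. -/
theorem cauchySeq_toLp_one (μ : Measure K) [IsFiniteMeasure μ] {g : ℕ → C(K, ℝ)} {c : ℝ}
    (hg : ∀ n x, |g n x| ≤ c) (h : ∀ x, CauchySeq fun n => g n x) :
    CauchySeq fun n => ContinuousMap.toLp (E := ℝ) 1 μ ℝ (g n) := by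
  rw [cauchySeq_iff_tendsto_dist_atTop_0]
  simp only [dist_toLp_one]
  have : Tendsto (fun p : ℕ × ℕ => ∫ x, |g p.1 x - g p.2 x| ∂μ) atTop (𝓝 (∫ _, (0 : ℝ) ∂μ)) := by
    refine tendsto_integral_filter_of_dominated_convergence (fun _ => c + c) ?_ ?_
      (integrable_const _) ?_
    · exact .of_forall fun p =>
        ((g p.1).continuous.sub (g p.2).continuous).abs.aestronglyMeasurable_of_compactSpace
    · refine .of_forall fun p => .of_forall fun x => ?_
      rw [Real.norm_eq_abs, abs_abs]
      exact (abs_sub _ _).trans (add_le_add (hg _ _) (hg _ _))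
    · exact .of_forall fun x => cauchySeq_iff_tendsto_dist_atTop_0.1 (h x)
  simpa using this

/-- If the continuous functions `g k` realize all sign patterns on the compact space `K`, then some
probability measure on `K` makes them pairwise uncorrelated, like Rademacher functions: it is a
cluster point of the uniform distributions on points that realize the `2 ^ n` sign patterns of
length `n`. -/
theorem exists_probabilityMeasure_integral_abs_sub_eq_one [T2Space K] {g : ℕ → C(K, ℝ)}
    (h : ∀ ε : ℕ → Bool, ∃ x, ∀ k, g k x = if ε k then 1 else -1) :
    ∃ μ : ProbabilityMeasure K, ∀ j k, j ≠ k → ∫ x, |g j x - g k x| ∂(μ : Measure K) = 1 := by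
  choose x hx using h
  have hfin : ∀ n : ℕ, ∃ μ : ProbabilityMeasure K, ∀ j < n, ∀ k < n, j ≠ k →
      ∫ x, |g j x - g k x| ∂(μ : Measure K) = 1 := by
    intro n
    let F : (Fin n → Bool) → K := fun ε => x fun k => if hk : k < n then ε ⟨k, hk⟩ else false
    have hF : Measurable F := .of_discrete
    refine ⟨⟨(PMF.uniformOfFintype (Fin n → Bool)).toMeasure.map F,
      Measure.isProbabilityMeasure_map hF.aemeasurable⟩, fun j hj k hk hjk => ?_⟩
    have hcont : Continuous fun x => |g j x - g k x| := (by fun_prop)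
    rw [ProbabilityMeasure.coe_mk, integral_map hF.aemeasurable
      hcont.aestronglyMeasurable_of_compactSpace, PMF.integral_eq_sum]
    let σ : Bool → ℝ := fun b => if b then 1 else -1
    have hval : ∀ ε, |g j (F ε) - g k (F ε)| = 1 - σ (ε ⟨j, hj⟩) * σ (ε ⟨k, hk⟩) := by
      intro ε
      simp only [F, hx, hj, hk, dif_pos, σ]
      cases ε ⟨j, hj⟩ <;> cases ε ⟨k, hk⟩ <;> norm_num
    -- Flipping the `j`-th sign shows that the correlation equals its own negative.
    have hflip : Function.Involutive fun ε : Fin n → Bool =>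
        Function.update ε ⟨j, hj⟩ (!ε ⟨j, hj⟩) := fun ε => by simp
    have hzero : ∑ ε : Fin n → Bool, σ (ε ⟨j, hj⟩) * σ (ε ⟨k, hk⟩) = 0 := by
      have := Equiv.sum_comp hflip.toPerm fun ε : Fin n → Bool => σ (ε ⟨j, hj⟩) * σ (ε ⟨k, hk⟩)
      have hne : (⟨k, hk⟩ : Fin n) ≠ ⟨j, hj⟩ := fun h => hjk (Fin.mk.inj h).symm
      have hσ : ∀ b, σ (!b) = -σ b := fun b => by cases b <;> simp [σ]
      simp only [Function.Involutive.coe_toPerm, Function.update_self,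
        Function.update_of_ne hne, hσ, neg_mul, Finset.sum_neg_distrib] at this
      linarith
    simp only [hval, PMF.uniformOfFintype_apply, smul_eq_mul, ← Finset.mul_sum,
      Finset.sum_sub_distrib, hzero]
    simp
  choose p hp using hfin
  let μ := ((hyperfilter ℕ).map p).lim
  have hμ : Tendsto p (hyperfilter ℕ) (𝓝 μ) := ((hyperfilter ℕ).map p).le_nhds_lim
  refine ⟨μ, fun j k hjk => ?_⟩
  have h1 := ProbabilityMeasure.tendsto_iff_forall_integral_tendsto.1 hμ
    (BoundedContinuousFunction.mkOfCompact ⟨fun x => |g j x - g k x|, by fun_prop⟩)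
  refine tendsto_nhds_unique h1 (tendsto_const_nhds.congr' ?_)
  filter_upwards [Nat.hyperfilter_le_atTop (eventually_gt_atTop j),
    Nat.hyperfilter_le_atTop (eventually_gt_atTop k)] with n hj hk
  exact (hp n j hj k hk hjk).symm

end Measures

section ConvexHull

variable {Z : Type*} [NormedAddCommGroup Z] [NormedSpace ℝ Z]

/-- A copy of `ℓ₁` provides a sequence in the unit ball on which uniformly bounded functionals take
all patterns of signs. -/
theorem ContainsEllOne.exists_signs (h : ContainsEllOne Z) :
    ∃ (u : ℕ → Z) (r : ℝ), (∀ k, ‖u k‖ ≤ 1) ∧ ∀ ε : ℕ → Bool, ∃ f : StrongDual ℝ Z, ‖f‖ ≤ r ∧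
      ∀ k, f (u k) = if ε k then 1 else -1 := by
  obtain ⟨Z₀, -, ⟨e⟩⟩ := h
  let T : lp (fun _ : ℕ => ℝ) 1 →L[ℝ] Z := Z₀.subtypeL ∘L (e : lp (fun _ : ℕ => ℝ) 1 →L[ℝ] Z₀)
  let E' : Z₀ →L[ℝ] lp (fun _ : ℕ => ℝ) 1 := e.symm
  have hD : 0 < ‖T‖ + 1 := by positivity
  refine ⟨fun k => (‖T‖ + 1)⁻¹ • T (lp.single 1 k 1), (‖T‖ + 1) * ‖E'‖, fun k => ?_, fun ε => ?_⟩
  · rw [norm_smul, Real.norm_of_nonneg (inv_nonneg.2 hD.le), inv_mul_le_one₀ hD]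
    have := T.le_opNorm (lp.single 1 k 1)
    rw [lp.norm_single one_pos, norm_one, mul_one] at this
    linarith
  · have hsign : ∀ k, ‖(if ε k then 1 else -1 : ℝ)‖ ≤ 1 := fun k => by split_ifs <;> simp
    obtain ⟨f, hf, hfn⟩ := exists_extension_norm_eq Z₀ (ellOneLift _ hsign ∘L E')
    refine ⟨(‖T‖ + 1) • f, ?_, fun k => ?_⟩
    · rw [norm_smul, Real.norm_of_nonneg hD.le, hfn]
      gcongr
      exact (ContinuousLinearMap.opNorm_comp_le _ _).trans
        (mul_le_of_le_one_left (norm_nonneg _) (norm_ellOneLift_le hsign))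
    · have : f (T (lp.single 1 k 1)) = if ε k then 1 else -1 := by
        refine (hf (e (lp.single 1 k 1))).trans ?_
        simp only [E', ContinuousLinearMap.comp_apply, ContinuousLinearEquiv.coe_coe,
          ContinuousLinearEquiv.symm_apply_apply, ellOneLift_single]
      rw [map_smul, _root_.smul_apply, this, inv_smul_smul₀ hD.ne']

/-- A normed space whose unit ball lies in the closed convex hull of a weakly precompact set `W`
contains no copy of `ℓ₁`. A copy of `ℓ₁` yields a probability measure `μ` on a weak* compact ball of
the dual such that the evaluation operator `Z → L¹(μ)` maps the basis to a separated sequence. By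
dominated convergence this operator maps `W`, hence its closed convex hull, to a totally bounded
set. -/
theorem WeaklyPrecompact.not_containsEllOne {W : Set Z} (hW : WeaklyPrecompact W)
    (hball : Metric.closedBall (0 : Z) 1 ⊆ closure (convexHull ℝ W)) : ¬ ContainsEllOne Z := by
  intro hZ
  obtain ⟨u, r, hu, hsign⟩ := hZ.exists_signs
  have hr : 0 ≤ r := by
    obtain ⟨f, hf, -⟩ := hsign fun _ => true
    exact (norm_nonneg f).trans hf
  let B : Set (WeakDual ℝ Z) := WeakDual.toStrongDual ⁻¹' Metric.closedBall 0 r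
  have hB : ∀ (f : B) z, |f.1 z| ≤ r * ‖z‖ := fun f z =>
    (WeakDual.toStrongDual f.1).le_of_opNorm_le (mem_closedBall_zero_iff.1 f.2) z
  have : CompactSpace B := isCompact_iff_compactSpace.1 (WeakDual.isCompact_closedBall 0 r)
  let _ : MeasurableSpace B := borel B
  have : BorelSpace B := ⟨rfl⟩
  let ev : Z →L[ℝ] C(B, ℝ) := LinearMap.mkContinuous
    { toFun := fun z => ⟨fun f => f.1 z, (WeakDual.eval_continuous z).comp continuous_subtype_val⟩
      map_add' := fun a b => by ext f; exact map_add f.1 a b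
      map_smul' := fun c a => by ext f; exact map_smul f.1 c a } r
    fun z => (ContinuousMap.norm_le _ (by positivity)).2 fun f => hB f z
  obtain ⟨μ, hμ⟩ := exists_probabilityMeasure_integral_abs_sub_eq_one (g := fun k => ev (u k))
    fun ε => by
      obtain ⟨f, hf, hfu⟩ := hsign ε
      exact ⟨⟨StrongDual.toWeakDual f, mem_closedBall_zero_iff.2 hf⟩, hfu⟩
  let T : Z →L[ℝ] Lp ℝ 1 (μ : Measure B) := ContinuousMap.toLp 1 (μ : Measure B) ℝ ∘L ev
  have hTW : TotallyBounded (T '' W) := by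
    refine totallyBounded_of_cauchySeq_subseq fun v hv => ?_
    choose w hw hwv using hv
    obtain ⟨φ, hφ, hc⟩ := hW w hw
    obtain ⟨c, hc'⟩ := hc.exists_norm_le
    refine ⟨φ, hφ, ?_⟩
    have := cauchySeq_toLp_one (μ : Measure B) (g := fun n => ev (w (φ n))) (c := r * c)
      (fun n f => (hB f _).trans (mul_le_mul_of_nonneg_left (hc' n) hr))
      fun f => hc (WeakDual.toStrongDual f.1)
    convert this using 2 with n
    exact (hwv (φ n)).symm
  have hTB : TotallyBounded (T '' Metric.closedBall 0 1) := by
    refine (totallyBounded_convexHull.2 hTW).closure.subset ?_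
    refine (Set.image_mono hball).trans ((image_closure_subset_closure_image T.continuous).trans ?_)
    exact closure_mono (T.toLinearMap.image_convexHull W).subset
  obtain ⟨t, ht, hcover⟩ := Metric.totallyBounded_iff.1 hTB (1 / 2) (by norm_num)
  have hmem : ∀ k, ∃ y : t, dist (T (u k)) y < 1 / 2 := fun k => by
    simpa using hcover ⟨u k, mem_closedBall_zero_iff.2 (hu k), rfl⟩
  choose y hy using hmem
  have : Finite t := ht
  obtain ⟨j, k, hjk, hyjk⟩ := Finite.exists_ne_map_eq_of_infinite y
  have hlt : dist (T (u j)) (T (u k)) < 1 / 2 + 1 / 2 :=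
    (dist_triangle_right _ _ _).trans_lt (add_lt_add (hy j) (hyjk ▸ hy k))
  have heq : dist (T (u j)) (T (u k)) = 1 := by
    rw [← hμ j k hjk]
    exact dist_toLp_one _ _ _
  linarith

end ConvexHull

/-! ### Bilinear functionals on weakly Cauchy sequences -/

section WeakSequences

variable {X Y : Type*} [NormedAddCommGroup X] [NormedSpace ℝ X]
  [NormedAddCommGroup Y] [NormedSpace ℝ Y]

theorem WeaklyCauchySeq.comp_tendsto {x : ℕ → X} (hx : WeaklyCauchySeq x) {n : ℕ → ℕ}
    (hn : Tendsto n atTop atTop) : WeaklyCauchySeq (x ∘ n) :=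
  fun f => (hx f).comp_tendsto hn

theorem WeaklyNullSeq.comp_tendsto {x : ℕ → X} (hx : WeaklyNullSeq x) {n : ℕ → ℕ}
    (hn : Tendsto n atTop atTop) : WeaklyNullSeq (x ∘ n) :=
  fun f => (hx f).comp hn

theorem WeaklyNullSeq.map {x : ℕ → X} (hx : WeaklyNullSeq x) (T : X →L[ℝ] Y) :
    WeaklyNullSeq fun n => T (x n) :=
  fun f => hx (f ∘L T)

theorem WeaklyNullSeq.weaklyCauchySeq {x : ℕ → X} (hx : WeaklyNullSeq x) : WeaklyCauchySeq x :=
  fun f => (hx f).cauchySeq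

theorem WeaklyCauchySeq.weaklyNullSeq_sub {x : ℕ → X} (hx : WeaklyCauchySeq x) {n m : ℕ → ℕ}
    (hn : Tendsto n atTop atTop) (hm : Tendsto m atTop atTop) :
    WeaklyNullSeq fun k => x (n k) - x (m k) := by
  intro f
  obtain ⟨l, hl⟩ := cauchySeq_tendsto_of_complete (hx f)
  simpa using (hl.comp hn).sub (hl.comp hm)

/-- A bilinear functional that is sequentially continuous at zero for the weak topologies is small
on pairs of a weakly null and a weakly Cauchy sequence. -/
theorem tendsto_zero_of_weaklyNullSeq_of_weaklyCauchySeq (S : X →L[ℝ] Y →L[ℝ] ℝ)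
    (hS : ∀ (x : ℕ → X) (y : ℕ → Y), WeaklyNullSeq x → WeaklyNullSeq y →
      Tendsto (fun n => S (x n) (y n)) atTop (𝓝 0))
    {x : ℕ → X} {y : ℕ → Y} (hx : WeaklyNullSeq x) (hy : WeaklyCauchySeq y) :
    Tendsto (fun n => S (x n) (y n)) atTop (𝓝 0) := by
  refine tendsto_of_subseq_tendsto fun n hn => ?_
  replace hx := hx.comp_tendsto hn
  replace hy := hy.comp_tendsto hn
  -- Choose `m k` so late that `S (x (n (m k))) (y (n k))` is negligible.
  have hex : ∀ k, ∃ m, k ≤ m ∧ |S (x (n m)) (y (n k))| < 1 / ((k : ℝ) + 1) := by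
    intro k
    have h0 : Tendsto (fun m => |S (x (n m)) (y (n k))|) atTop (𝓝 0) := by
      simpa using (hx (S.flip (y (n k)))).abs
    exact ((eventually_ge_atTop k).and (h0.eventually_lt_const Nat.one_div_pos_of_nat)).exists
  choose m hm hS' using hex
  have hmt : Tendsto m atTop atTop := tendsto_atTop_mono hm tendsto_id
  refine ⟨m, ?_⟩
  have h1 := hS _ _ (hx.comp_tendsto hmt) (hy.weaklyNullSeq_sub hmt tendsto_id)
  have h2 : Tendsto (fun k => S (x (n (m k))) (y (n k))) atTop (𝓝 0) :=
    squeeze_zero_norm (fun k => (hS' k).le) tendsto_one_div_add_atTop_nhds_zero_nat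
  simpa using h1.add h2

/-- Bilinear functionals that are sequentially continuous at zero for the weak topologies map weakly
Cauchy sequences to Cauchy sequences: expand
`S xₙ yₙ - S xₘ yₘ = S (xₙ - xₘ) yₙ + S xₘ (yₙ - yₘ)`. -/
theorem cauchySeq_of_weaklyCauchySeq (S : X →L[ℝ] Y →L[ℝ] ℝ)
    (hS : ∀ (x : ℕ → X) (y : ℕ → Y), WeaklyNullSeq x → WeaklyNullSeq y →
      Tendsto (fun n => S (x n) (y n)) atTop (𝓝 0))
    {x : ℕ → X} {y : ℕ → Y} (hx : WeaklyCauchySeq x) (hy : WeaklyCauchySeq y) :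
    CauchySeq fun n => S (x n) (y n) := by
  rw [cauchySeq_iff_tendsto_dist_atTop_0]
  refine tendsto_of_seq_tendsto fun p hp => ?_
  rw [← prod_atTop_atTop_eq] at hp
  have hn : Tendsto (fun k => (p k).1) atTop atTop := tendsto_fst.comp hp
  have hm : Tendsto (fun k => (p k).2) atTop atTop := tendsto_snd.comp hp
  have h1 := tendsto_zero_of_weaklyNullSeq_of_weaklyCauchySeq S hS (hx.weaklyNullSeq_sub hn hm)
    (hy.comp_tendsto hn)
  have h2 := tendsto_zero_of_weaklyNullSeq_of_weaklyCauchySeq S.flip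
    (fun y x hy hx => hS x y hx hy) (hy.weaklyNullSeq_sub hn hm) (hx.comp_tendsto hm)
  have h3 := (h1.add h2).abs
  simp only [add_zero, abs_zero] at h3
  refine h3.congr fun k => ?_
  simp [Real.dist_eq]

/-- Compact operators are completely continuous. -/
theorem IsCompactOperator.tendsto_zero_of_weaklyNullSeq {T : X →L[ℝ] Y} (hT : IsCompactOperator T)
    {x : ℕ → X} (hx : WeaklyNullSeq x) : Tendsto (fun n => T (x n)) atTop (𝓝 0) := by
  obtain ⟨c, hc⟩ := hx.weaklyCauchySeq.exists_norm_le
  have hK := hT.isCompact_closure_image_closedBall c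
  refine tendsto_of_subseq_tendsto fun n hn => ?_
  obtain ⟨g, -, φ, hφ, hg⟩ := hK.tendsto_subseq (x := fun k => T (x (n k)))
    fun k => subset_closure ⟨x (n k), mem_closedBall_zero_iff.2 (hc _), rfl⟩
  refine ⟨φ, ?_⟩
  have hg0 : g = 0 := by
    refine SeparatingDual.eq_zero_of_forall_dual_eq_zero (R := ℝ) fun f => ?_
    exact tendsto_nhds_unique ((f.continuous.tendsto g).comp hg)
      ((hx.map T f).comp (hn.comp hφ.tendsto_atTop))
  rwa [hg0] at hg

theorem tendsto_zero_of_dunfordPettis_or_isCompactOperator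
    (h : (DunfordPettisProperty X ∨ DunfordPettisProperty Y) ∨
      ∀ T : X →L[ℝ] StrongDual ℝ Y, IsCompactOperator T) (S : X →L[ℝ] Y →L[ℝ] ℝ)
    {x : ℕ → X} {y : ℕ → Y} (hx : WeaklyNullSeq x) (hy : WeaklyNullSeq y) :
    Tendsto (fun n => S (x n) (y n)) atTop (𝓝 0) := by
  rcases h with (hX | hY) | hT
  · exact hX x (fun n => S.flip (y n)) hx (hy.map S.flip)
  · exact hY y (fun n => S (x n)) hy (hx.map S)
  · obtain ⟨c, hc⟩ := hy.weaklyCauchySeq.exists_norm_le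
    have h0 := ((hT S).tendsto_zero_of_weaklyNullSeq hx).norm.mul_const c
    rw [norm_zero, zero_mul] at h0
    refine squeeze_zero_norm (fun n => ?_) h0
    exact ((S (x n)).le_opNorm (y n)).trans (mul_le_mul_of_nonneg_left (hc n) (norm_nonneg _))

end WeakSequences

/-! ### The projective tensor product -/

namespace ProjTensor

variable {X Y : Type*} [NormedAddCommGroup X] [NormedSpace ℝ X]
  [NormedAddCommGroup Y] [NormedSpace ℝ Y]

theorem norm_tmul_le (x : X) (y : Y) : ‖tmul x y‖ ≤ ‖x‖ * ‖y‖ := by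
  rw [tmul, UniformSpace.Completion.norm_coe, AlgTensor.norm_def]
  refine AlgTensor.projNorm_le fun S hS => ?_
  rw [AlgTensor.extend_tmul]
  refine (S.le_opNorm₂ x y).trans ?_
  rw [mul_assoc]
  exact mul_le_of_le_one_left (by positivity) hS

/-- The continuous bilinear functional `(x, y) ↦ f (x ⊗ y)`. -/
noncomputable def toBilin (f : StrongDual ℝ (ProjTensor X Y)) : X →L[ℝ] Y →L[ℝ] ℝ :=
  LinearMap.mkContinuous₂
    (LinearMap.mk₂ ℝ (fun x y => f (tmul x y))
      (fun a b y => by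
        rw [← map_add, tmul, tmul, tmul, ← UniformSpace.Completion.coe_add]
        exact congrArg (fun z : AlgTensor X Y => f z) (TensorProduct.add_tmul a b y))
      (fun c a y => by
        rw [← map_smul, tmul, tmul, ← UniformSpace.Completion.coe_smul]
        exact congrArg (fun z : AlgTensor X Y => f z) (TensorProduct.smul_tmul' c a y).symm)
      (fun a b y => by
        rw [← map_add, tmul, tmul, tmul, ← UniformSpace.Completion.coe_add]
        exact congrArg (fun z : AlgTensor X Y => f z) (TensorProduct.tmul_add a b y))
      (fun c a y => by
        rw [← map_smul, tmul, tmul, ← UniformSpace.Completion.coe_smul]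
        exact congrArg (fun z : AlgTensor X Y => f z) (TensorProduct.tmul_smul c a y))) ‖f‖
    fun x y => (f.le_opNorm _).trans <| by
      rw [mul_assoc]
      exact mul_le_mul_of_nonneg_left (norm_tmul_le x y) (norm_nonneg f)

theorem extend_toBilin (f : StrongDual ℝ (ProjTensor X Y)) (z : AlgTensor X Y) :
    AlgTensor.extend (toBilin f) z = f z := by
  refine TensorProduct.induction_on
    (motive := fun w => (fun z : AlgTensor X Y => AlgTensor.extend (toBilin f) z = f z) w) z ?_ ?_ ?_
  · exact (map_zero (AlgTensor.extend (toBilin f))).trans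
      ((congrArg f UniformSpace.Completion.coe_zero).trans (map_zero f)).symm
  · exact fun x y => rfl
  · intro a b ha hb
    refine (map_add (AlgTensor.extend (toBilin f)) a b).trans ?_
    refine (congrArg₂ (· + ·) ha hb).trans ?_
    refine (map_add f _ _).symm.trans (congrArg f ?_)
    exact (UniformSpace.Completion.coe_add (α := AlgTensor X Y) a b).symm

theorem abs_apply_le_norm_of_norm_toBilin_le_one (f : StrongDual ℝ (ProjTensor X Y))
    (hf : ‖toBilin f‖ ≤ 1) (z : ProjTensor X Y) : |f z| ≤ ‖z‖ := by
  induction z using UniformSpace.Completion.induction_on with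
  | hp => exact isClosed_le f.continuous.abs continuous_norm
  | ih z =>
    rw [← extend_toBilin, UniformSpace.Completion.norm_coe, AlgTensor.norm_def]
    exact AlgTensor.abs_extend_le_projNorm _ hf z

/-- The unit ball of the projective tensor product lies in the closed convex hull of the elementary
tensors of vectors of norm at most one. -/
theorem closedBall_subset_closure_convexHull :
    Metric.closedBall (0 : ProjTensor X Y) 1 ⊆ closure (convexHull ℝ
      (Set.image2 tmul (Metric.closedBall (0 : X) 1) (Metric.closedBall (0 : Y) 1))) := by
  intro z hz
  by_contra hzW
  obtain ⟨f, u, hlt, hu⟩ :=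
    geometric_hahn_banach_closed_point (convex_convexHull ℝ _).closure isClosed_closure hzW
  have hW : ∀ x y, ‖x‖ ≤ 1 → ‖y‖ ≤ 1 → toBilin f x y < u := fun x y hx hy =>
    hlt _ (subset_closure (subset_convexHull ℝ _
      ⟨x, mem_closedBall_zero_iff.2 hx, y, mem_closedBall_zero_iff.2 hy, rfl⟩))
  have hu0 : 0 < u := by simpa using hW 0 0 (by simp) (by simp)
  have hnorm : ‖toBilin (u⁻¹ • f)‖ ≤ 1 := by
    refine ContinuousLinearMap.opNorm_le_of_unit_norm zero_le_one fun x hx => ?_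
    refine ContinuousLinearMap.opNorm_le_of_unit_norm zero_le_one fun y hy => ?_
    have h1 := hW x y hx.le hy.le
    have h2 := hW (-x) y (by rw [norm_neg, hx]) hy.le
    rw [map_neg, _root_.neg_apply] at h2
    have h3 : toBilin (u⁻¹ • f) x y = u⁻¹ * toBilin f x y := rfl
    rw [h3, Real.norm_eq_abs, abs_mul, abs_of_pos (inv_pos.2 hu0), inv_mul_le_one₀ hu0, abs_le]
    constructor <;> linarith
  have h1 := (abs_apply_le_norm_of_norm_toBilin_le_one _ hnorm z).trans (mem_closedBall_zero_iff.1 hz)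
  have h2 := (le_abs_self _).trans h1
  rw [_root_.smul_apply, smul_eq_mul, inv_mul_le_one₀ hu0] at h2
  linarith

theorem weaklyCauchySeq_tmul
    (h : (DunfordPettisProperty X ∨ DunfordPettisProperty Y) ∨
      ∀ T : X →L[ℝ] StrongDual ℝ Y, IsCompactOperator T)
    {x : ℕ → X} {y : ℕ → Y} (hx : WeaklyCauchySeq x) (hy : WeaklyCauchySeq y) :
    WeaklyCauchySeq fun n => tmul (x n) (y n) := fun f =>
  cauchySeq_of_weaklyCauchySeq (toBilin f)
    (fun _ _ => tendsto_zero_of_dunfordPettis_or_isCompactOperator h (toBilin f)) hx hy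

theorem weaklyPrecompact_image2_tmul
    (h : (DunfordPettisProperty X ∨ DunfordPettisProperty Y) ∨
      ∀ T : X →L[ℝ] StrongDual ℝ Y, IsCompactOperator T)
    {W₁ : Set X} {W₂ : Set Y} (h₁ : WeaklyPrecompact W₁) (h₂ : WeaklyPrecompact W₂) :
    WeaklyPrecompact (Set.image2 (tmul (X := X) (Y := Y)) W₁ W₂) := by
  intro z hz
  choose x hx y hy hz using hz
  obtain ⟨φ, hφ, hxφ⟩ := h₁ x hx
  obtain ⟨ψ, hψ, hyψ⟩ := h₂ (y ∘ φ) fun n => hy _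
  refine ⟨φ ∘ ψ, hφ.comp hψ, ?_⟩
  have := weaklyCauchySeq_tmul h (hxφ.comp_tendsto hψ.tendsto_atTop) hyψ
  simpa only [Function.comp_def, hz] using this

end ProjTensor

theorem theorem4p6 {X Y : Type*}
    [NormedAddCommGroup X] [NormedSpace ℝ X] [CompleteSpace X]
    [NormedAddCommGroup Y] [NormedSpace ℝ Y] [CompleteSpace Y]
    (h : (DunfordPettisProperty X ∨ DunfordPettisProperty Y) ∨
      ∀ T : X →L[ℝ] StrongDual ℝ Y, IsCompactOperator T) :
    (∀ (x : ℕ → X) (y : ℕ → Y), WeaklyCauchySeq x → WeaklyCauchySeq y →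
      WeaklyCauchySeq fun n => ProjTensor.tmul (x n) (y n)) ∧
    (∀ (W₁ : Set X) (W₂ : Set Y), WeaklyPrecompact W₁ → WeaklyPrecompact W₂ →
      WeaklyPrecompact (Set.image2 (ProjTensor.tmul (X := X) (Y := Y)) W₁ W₂)) ∧
    (¬ ContainsEllOne X → ¬ ContainsEllOne Y → ¬ ContainsEllOne (ProjTensor X Y)) := by
  refine ⟨fun x y => ProjTensor.weaklyCauchySeq_tmul h,
    fun W₁ W₂ => ProjTensor.weaklyPrecompact_image2_tmul h, fun hX hY => ?_⟩
  exact (ProjTensor.weaklyPrecompact_image2_tmul h (weaklyPrecompact_closedBall hX)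
    (weaklyPrecompact_closedBall hY)).not_containsEllOne
    ProjTensor.closedBall_subset_closure_convexHull
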